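/- All graphs are finite and simple. The clique-width of a graph is the minimum number of labels needed to construct it by creating a labelled vertex, taking disjoint unions, adding all edges between two distinct label classes, and relabelling one label class to another label; a class of graphs has unbounded clique-width if no constant bounds the clique-width of all its members. An atom is a graph with no clique cut-set, that is, with no (possibly empty) clique whose removal leaves a disconnected graph. A graph is $(F_1,\dots,F_p)$-free if it contains none of $F_1,\dots,F_p$ as an induced subgraph. $P_t$ is the path on $t$ vertices, $+$ is disjoint union, and $\overline{F}$ is the complement of $F$; the diamond is $\overline{2P_1+P_2}$. For $n\ge 2$, the wall of height $n$ is the graph whose vertices are the pairs $(x,y)$ of integers with $0\le x\le 2n+1$, $0\le y\le n$, in which $(x,y)$ and $(x+1,y)$ are adjacent, and $(x,y)$ and $(x,y+1)$ are adjacent if and only if $x+y$ is odd, after deleting the two vertices of degree one, namely $(0,0)$ and $(2n+1,n)$ if $n$ is even, or $(0,0)$ and $(0,n)$ if $n$ is odd. It is bipartite; let $A$ and $C$ be its two sides. Let $H_n$ be the graph obtained by replacing every edge of the wall by a path with two edges, adding all edges between $A$ and $C$, and adding one new vertex $x$ adjacent to exactly the set $B$ of subdivision vertices. Lemma. (i)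 The class of $(\overline{2P_1+P_2},\,P_2+P_4,\,P_1+P_6)$-free atoms and the class of $(2P_1+P_2,\,\overline{P_2+P_4},\,\overline{P_1+P_6})$-free atoms both have unbounded clique-width. (ii) This is witnessed by the graphs $H_n$ and their complements: for every $n\ge 2$, $H_n$ is a $(\overline{2P_1+P_2},P_2+P_4,P_1+P_6)$-free atom and $\overline{H_n}$ is a $(2P_1+P_2,\overline{P_2+P_4},\overline{P_1+P_6})$-free atom, and both families $\{H_n : n\ge 2\}$ and $\{\overline{H_n} : n\ge 2\}$ have unbounded clique-width. -/

import Mathlib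

/-! ### Clique-width -/

/-- `LabelledConstructible k G l`: the graph `G` with the labelling `l` of its vertices by `k` labels
can be built (up to isomorphism) using the four clique-width operations. -/
inductive LabelledConstructible (k : ℕ) : {V : Type} → SimpleGraph V → (V → Fin k) → Prop
  /-- create a new graph consisting of a single vertex with label `i` -/
  | vertex (i : Fin k) : LabelledConstructible k (⊥ : SimpleGraph Unit) (fun _ => i)
  /-- take the disjoint union of two labelled graphs -/
  | union {V W : Type} {G : SimpleGraph V} {H : SimpleGraph W} {l : V → Fin k} {m : W → Fin k}
      (hG : LabelledConstructible k G l) (hH : LabelledConstructible k H m) :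
      LabelledConstructible k (SimpleGraph.sum G H) (Sum.elim l m)
  /-- add an edge between every vertex with label `i` and every vertex with label `j`, `i ≠ j` -/
  | join {V : Type} {G : SimpleGraph V} {l : V → Fin k} (i j : Fin k) (hij : i ≠ j)
      (hG : LabelledConstructible k G l) :
      LabelledConstructible k (G ⊔ SimpleGraph.fromRel (fun u v => l u = i ∧ l v = j)) l
  /-- relabel every vertex with label `i` to have label `j` -/
  | relabel {V : Type} {G : SimpleGraph V} {l : V → Fin k} (i j : Fin k)
      (hG : LabelledConstructible k G l) :
      LabelledConstructible k G (fun v => if l v = i then j else l v)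
  /-- rename the vertices along an isomorphism -/
  | iso {V W : Type} {G : SimpleGraph V} {H : SimpleGraph W} {l : V → Fin k} (e : G ≃g H)
      (hG : LabelledConstructible k G l) : LabelledConstructible k H (fun w => l (e.symm w))

/-- `G` can be constructed with `k` labels (the graph without vertices needs no construction). -/
def ConstructibleWith {V : Type} (k : ℕ) (G : SimpleGraph V) : Prop :=
  IsEmpty V ∨ ∃ l : V → Fin k, LabelledConstructible k G l

/-- The clique-width: the minimum number of labels needed to construct `G`
(`⊤` if `G` cannot be constructed, which happens only for infinite graphs). -/
noncomputable def cliqueWidth {V : Type} (G : SimpleGraph V) : ℕ∞ :=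
  ⨅ (k : ℕ) (_ : ConstructibleWith k G), (k : ℕ∞)

/-- A class of graphs; only its finite members matter below. -/
abbrev GraphClass : Type 1 := ∀ V : Type, SimpleGraph V → Prop

/-- One constant bounds the clique-width of every (finite) graph in the class. -/
def BoundedCliqueWidth (𝒢 : GraphClass) : Prop :=
  ∃ c : ℕ, ∀ (V : Type) [Finite V] (G : SimpleGraph V), 𝒢 V G → cliqueWidth G ≤ (c : ℕ∞)

/-! ### Atoms and forbidden induced subgraphs -/

/-- A clique whose removal leaves a disconnected graph.
(The graph without vertices is not disconnected.) -/
def IsCliqueCutset {V : Type} (G : SimpleGraph V) (K : Set V) : Prop :=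
  G.IsClique K ∧ ¬ (G.induce Kᶜ).Preconnected

/-- An atom is a graph with no clique cut-set. -/
def IsAtomGraph {V : Type} (G : SimpleGraph V) : Prop :=
  ∀ K : Set V, ¬ IsCliqueCutset G K

/-- `G` is `H`-free: it has no induced subgraph isomorphic to `H`. -/
def IsFreeOf {W V : Type} (H : SimpleGraph W) (G : SimpleGraph V) : Prop :=
  ¬ H.IsIndContained G

/-- `2P₁ + P₂`; its complement is the diamond. -/
abbrev twoP1AddP2 : SimpleGraph ((Fin 1 ⊕ Fin 1) ⊕ Fin 2) :=
  SimpleGraph.sum (SimpleGraph.sum (SimpleGraph.pathGraph 1) (SimpleGraph.pathGraph 1))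
    (SimpleGraph.pathGraph 2)

/-- `P₂ + P₄`. -/
abbrev P2AddP4 : SimpleGraph (Fin 2 ⊕ Fin 4) :=
  SimpleGraph.sum (SimpleGraph.pathGraph 2) (SimpleGraph.pathGraph 4)

/-- `P₁ + P₆`. -/
abbrev P1AddP6 : SimpleGraph (Fin 1 ⊕ Fin 6) :=
  SimpleGraph.sum (SimpleGraph.pathGraph 1) (SimpleGraph.pathGraph 6)

/-- The class of (diamond, `P₂ + P₄`, `P₁ + P₆`)-free atoms. -/
def diamondFreeAtoms : GraphClass := fun _ G =>
  IsAtomGraph G ∧ IsFreeOf twoP1AddP2ᶜ G ∧ IsFreeOf P2AddP4 G ∧ IsFreeOf P1AddP6 G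

/-- The class of (`2P₁ + P₂`, co-(`P₂ + P₄`), co-(`P₁ + P₆`))-free atoms. -/
def coDiamondFreeAtoms : GraphClass := fun _ G =>
  IsAtomGraph G ∧ IsFreeOf twoP1AddP2 G ∧ IsFreeOf P2AddP4ᶜ G ∧ IsFreeOf P1AddP6ᶜ G

/-! ### Walls and the witness graphs -/

/-- Vertices of the wall of height `n`: pairs `(x, y)` with `0 ≤ x ≤ 2n + 1` and `0 ≤ y ≤ n`
(column `x`, row `y`), without the two corners that would have degree one. -/
def WallVertex (n : ℕ) : Type :=
  {p : Fin (2 * n + 2) × Fin (n + 1) //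
    ¬ (p.1.val = 0 ∧ p.2.val = 0) ∧
    ¬ (p.1.val = (if Even n then 2 * n + 1 else 0) ∧ p.2.val = n)}

/-- The wall of height `n` (`n` layers of `n` bricks). Horizontally consecutive vertices are
adjacent, and `(x, y)` is adjacent to `(x, y + 1)` exactly when `x + y` is odd. -/
def wall (n : ℕ) : SimpleGraph (WallVertex n) :=
  SimpleGraph.fromRel fun p q =>
    (p.1.2.val = q.1.2.val ∧ p.1.1.val + 1 = q.1.1.val) ∨
    (p.1.1.val = q.1.1.val ∧ p.1.2.val + 1 = q.1.2.val ∧ Odd (p.1.1.val + p.1.2.val))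

/-- One side of the bipartition of the wall. -/
def wallSide (n : ℕ) : Set (WallVertex n) := {p | Even (p.1.1.val + p.1.2.val)}

/-- The wall is bipartite with sides `wallSide n` and its complement. -/
theorem wall_isBipartiteWith (n : ℕ) :
    (wall n).IsBipartiteWith (wallSide n) (wallSide n)ᶜ := by
  refine ⟨disjoint_compl_right, ?_⟩
  intro p q h
  simp only [wall, SimpleGraph.fromRel_adj] at h
  simp only [wallSide, Set.mem_ofPred_eq, Set.mem_compl_iff]
  grind

/-- Given a graph `W` with a bipartition into `A` and `Aᶜ`: take the 1-subdivision of `W`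
(vertices `V ⊕ B` where `B = W.edgeSet` is the set of subdivision vertices), make `A` complete to
`Aᶜ`, and add one more vertex `x` (the vertex `inr (inr ())`) that is complete to `B`. -/
def joinedSubdivision {V : Type} (W : SimpleGraph V) (A : Set V) :
    SimpleGraph (V ⊕ (W.edgeSet ⊕ Unit)) :=
  SimpleGraph.fromRel fun a b =>
    match a, b with
    | .inl u, .inl v => u ∈ A ∧ v ∉ A
    | .inl v, .inr (.inl e) => v ∈ (e : Sym2 V)
    | .inr (.inl _), .inr (.inr _) => True
    | _, _ => False

/-- The witness graph obtained from the wall of height `n`. -/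
def witness (n : ℕ) : SimpleGraph (WallVertex n ⊕ ((wall n).edgeSet ⊕ Unit)) :=
  joinedSubdivision (wall n) (wallSide n)

/-- The class of all witness graphs for `n ≥ 2` (up to isomorphism). -/
def witnessClass : GraphClass := fun _ G => ∃ n : ℕ, 2 ≤ n ∧ Nonempty (G ≃g witness n)

/-- The class of all complements of witness graphs for `n ≥ 2` (up to isomorphism). -/
def coWitnessClass : GraphClass := fun _ G => ∃ n : ℕ, 2 ≤ n ∧ Nonempty (G ≃g (witness n)ᶜ)

/-! In a construction with `k` labels, descend through the disjoint unions, always to a part holding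
more than `t` vertices of a given set `D`, until it holds at most `2 * t`. Let `S` be the part
reached: later operations treat equally labelled vertices of `S` alike, so `S` has at most `k`
neighbourhoods outside itself. Let `D` be a grid of wall vertices. If few rows and few columns are
cut by `S`, almost all of `D` lies on one side of `S`, contrary to balance
(`ncard_le_of_few_mixed`). So many rows or columns contain a cut wall edge, and one half of each
subdivided edge is cut. These halves form a matching that is induced as far as edges between wall
vertices and subdivision vertices are concerned, and the edges between `A` and `C` do not affect
those. This forces many neighbourhoods (`HasFewNeighbourhoods.card_le_of_cut_edges`). The
obstruction survives complementation. Freeness follows from the layers `A`, `C`, `B`, `x` alone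
(`IsLayered`). The atom property uses minimum degree two for `H_n`, and for its complement that no
edge covers a side of the wall. -/

/-- A graph built with `k` labels has, for each set `D` of more than `t ≥ 1` vertices, a vertex set
`S` meeting `D` in between `t + 1` and `2 * t` vertices whose vertices see at most `k` different
neighbourhoods outside `S`. -/
theorem LabelledConstructible.exists_balanced {k : ℕ} {V : Type} {G : SimpleGraph V}
    {l : V → Fin k} (h : LabelledConstructible k G l) {t : ℕ} (ht : 1 ≤ t) :
    ∀ D : Set V, D.Finite → t < D.ncard → ∃ (S : Set V) (f : V → Fin k),
      t < (D ∩ S).ncard ∧ (D ∩ S).ncard ≤ 2 * t ∧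
      ∀ u ∈ S, ∀ v ∈ S, f u = f v → l u = l v ∧ ∀ z ∉ S, (G.Adj u z ↔ G.Adj v z) := by
  induction h with
  | vertex i =>
    intro D _ hD
    have := Set.ncard_le_one_iff_subsingleton.2 (Set.subsingleton_of_subsingleton (s := D))
    omega
  | @union V W G H l m _ _ ihG ihH =>
    intro D hf hD
    -- With `D` small enough the whole graph serves: nothing lies outside it, and the labels
    -- themselves are the classes.
    by_cases h2 : D.ncard ≤ 2 * t
    · exact ⟨Set.univ, Sum.elim l m, by simpa using hD, by simpa using h2,
        fun u _ v _ huv => ⟨huv, fun z hz => absurd trivial hz⟩⟩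
    have hfl := hf.preimage (Sum.inl_injective (α := V) (β := W)).injOn
    have hfr := hf.preimage (Sum.inr_injective (α := V) (β := W)).injOn
    have hsum : D.ncard = (Sum.inl ⁻¹' D : Set V).ncard + (Sum.inr ⁻¹' D : Set W).ncard := by
      rw [← Set.ncard_image_of_injective _ (Sum.inl_injective (α := V) (β := W)),
        ← Set.ncard_image_of_injective _ (Sum.inr_injective (α := V) (β := W)),
        ← Set.ncard_union_eq _ (hfl.image _) (hfr.image _),
        Set.image_preimage_inl_union_image_preimage_inr]
      rw [Set.disjoint_left]
      rintro _ ⟨a, _, rfl⟩ ⟨b, _, hb⟩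
      cases hb
    -- More than `2 * t` vertices leave more than `t` in one summand; the other summand sends no
    -- edges to it.
    rcases (by omega : t < (Sum.inl ⁻¹' D : Set V).ncard ∨ t < (Sum.inr ⁻¹' D : Set W).ncard)
      with hl | hr
    · obtain ⟨S, f, h1, h2, h3⟩ := ihG _ hfl hl
      have e : (D ∩ Sum.inl '' S).ncard = (Sum.inl ⁻¹' D ∩ S).ncard := by
        rw [← Set.ncard_image_of_injective _ (Sum.inl_injective (α := V) (β := W)),
          Set.image_preimage_inter]
      refine ⟨Sum.inl '' S, Sum.elim f m, by omega, by omega, ?_⟩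
      rintro _ ⟨u, hu, rfl⟩ _ ⟨v, hv, rfl⟩ huv
      obtain ⟨h4, h5⟩ := h3 u hu v hv huv
      refine ⟨h4, ?_⟩
      rintro (z | z) hz
      · simpa using h5 z fun hz' => hz ⟨z, hz', rfl⟩
      · simp
    · obtain ⟨S, f, h1, h2, h3⟩ := ihH _ hfr hr
      have e : (D ∩ Sum.inr '' S).ncard = (Sum.inr ⁻¹' D ∩ S).ncard := by
        rw [← Set.ncard_image_of_injective _ (Sum.inr_injective (α := V) (β := W)),
          Set.image_preimage_inter]
      refine ⟨Sum.inr '' S, Sum.elim l f, by omega, by omega, ?_⟩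
      rintro _ ⟨u, hu, rfl⟩ _ ⟨v, hv, rfl⟩ huv
      obtain ⟨h4, h5⟩ := h3 u hu v hv huv
      refine ⟨h4, ?_⟩
      rintro (z | z) hz
      · simp
      · simpa using h5 z fun hz' => hz ⟨z, hz', rfl⟩
  | join i j hij _ ih =>
    intro D hf hD
    obtain ⟨S, f, h1, h2, h3⟩ := ih D hf hD
    refine ⟨S, f, h1, h2, fun u hu v hv huv => ?_⟩
    obtain ⟨h4, h5⟩ := h3 u hu v hv huv
    refine ⟨h4, fun z hz => ?_⟩
    have hu' : u ≠ z := fun h => hz (h ▸ hu)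
    have hv' : v ≠ z := fun h => hz (h ▸ hv)
    -- Carrying `l u = l v` through the induction pays off here: a join treats `u` and `v` alike.
    simp [h4, h5 z hz, hu', hv']
  | relabel i j _ ih =>
    intro D hf hD
    obtain ⟨S, f, h1, h2, h3⟩ := ih D hf hD
    refine ⟨S, f, h1, h2, fun u hu v hv huv => ?_⟩
    obtain ⟨h4, h5⟩ := h3 u hu v hv huv
    exact ⟨by simp [h4], h5⟩
  | @iso V W G H l e _ ih =>
    intro D hf hD
    have hc (E : Set W) : (e ⁻¹' E).ncard = E.ncard := by
      exact Set.ncard_preimage_of_injective_subset_range e.injective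
        (by simp [e.surjective.range_eq])
    obtain ⟨S, f, h1, h2, h3⟩ := ih (e ⁻¹' D) (hf.preimage e.injective.injOn) (by rwa [hc])
    have hS : e ⁻¹' D ∩ S = e ⁻¹' (D ∩ e.symm ⁻¹' S) := by
      ext a; simp
    rw [hS, hc] at h1 h2
    refine ⟨e.symm ⁻¹' S, fun w => f (e.symm w), h1, h2, fun u hu v hv huv => ?_⟩
    obtain ⟨h4, h5⟩ := h3 _ hu _ hv huv
    refine ⟨h4, fun z hz => ?_⟩
    simpa only [e.symm.map_adj_iff] using h5 (e.symm z) hz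

/-- `S` has at most `k` different neighbourhoods outside `S`. -/
def HasFewNeighbourhoods {V : Type} (G : SimpleGraph V) (k : ℕ) (S : Set V) : Prop :=
  ∃ f : V → Fin k, ∀ u ∈ S, ∀ v ∈ S, f u = f v → ∀ z ∉ S, (G.Adj u z ↔ G.Adj v z)

/-- Since `z ∉ S` differs from `u` and `v`, complementation negates both sides of the equivalence.
One lower bound thus serves both families. -/
theorem HasFewNeighbourhoods.of_compl {V : Type} {G : SimpleGraph V} {k : ℕ} {S : Set V}
    (h : HasFewNeighbourhoods Gᶜ k S) : HasFewNeighbourhoods G k S := by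
  obtain ⟨f, hf⟩ := h
  refine ⟨f, fun u hu v hv huv z hz => ?_⟩
  have := hf u hu v hv huv z hz
  have hu' : u ≠ z := fun h => hz (h ▸ hu)
  have hv' : v ≠ z := fun h => hz (h ▸ hv)
  simpa [SimpleGraph.compl_adj, hu', hv', not_iff_not] using this

theorem HasFewNeighbourhoods.mono {V : Type} {G : SimpleGraph V} {k c : ℕ} {S : Set V}
    (h : HasFewNeighbourhoods G k S) (hkc : k ≤ c) : HasFewNeighbourhoods G c S := by
  obtain ⟨f, hf⟩ := h
  exact ⟨fun v => Fin.castLE hkc (f v), fun u hu v hv huv =>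
    hf u hu v hv (Fin.castLE_injective hkc huv)⟩

theorem exists_balanced_of_cliqueWidth_le {V : Type} [Finite V] {G : SimpleGraph V} {c t : ℕ}
    (h : cliqueWidth G ≤ (c : ℕ∞)) (ht : 1 ≤ t) (D : Set V) (hD : t < D.ncard) :
    ∃ S : Set V, t < (D ∩ S).ncard ∧ (D ∩ S).ncard ≤ 2 * t ∧ HasFewNeighbourhoods G c S := by
  obtain ⟨k, hk, hkc⟩ : ∃ k, ConstructibleWith k G ∧ k ≤ c := by
    by_contra! hcon
    have : ((c + 1 : ℕ) : ℕ∞) ≤ cliqueWidth G :=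
      le_iInf₂ fun k hk => by exact_mod_cast hcon k hk
    have h2 := this.trans h
    norm_cast at h2
    omega
  rcases hk with hV | ⟨l, hl⟩
  · rw [Set.eq_empty_of_isEmpty D] at hD
    simp at hD
  · obtain ⟨S, f, h1, h2, h3⟩ := hl.exists_balanced ht D D.toFinite hD
    exact ⟨S, h1, h2, HasFewNeighbourhoods.mono
      ⟨f, fun u hu v hv huv => (h3 u hu v hv huv).2⟩ hkc⟩

/-! ### Cut edges and neighbourhoods in the joined subdivision -/

section JoinedSubdivision

variable {V : Type} {W : SimpleGraph V} {A : Set V}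

@[simp]
theorem joinedSubdivision_adj_inl_inl {u v : V} :
    (joinedSubdivision W A).Adj (.inl u) (.inl v) ↔ ¬(u ∈ A ↔ v ∈ A) := by
  simp only [joinedSubdivision, SimpleGraph.fromRel_adj, ne_eq, Sum.inl.injEq]
  grind

@[simp]
theorem joinedSubdivision_adj_inl_edge {v : V} {e : W.edgeSet} :
    (joinedSubdivision W A).Adj (.inl v) (.inr (.inl e)) ↔ v ∈ (e : Sym2 V) := by
  simp [joinedSubdivision]

@[simp]
theorem joinedSubdivision_adj_edge_inl {v : V} {e : W.edgeSet} :
    (joinedSubdivision W A).Adj (.inr (.inl e)) (.inl v) ↔ v ∈ (e : Sym2 V) := by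
  simp [joinedSubdivision]

@[simp]
theorem joinedSubdivision_adj_edge_edge {e e' : W.edgeSet} :
    ¬(joinedSubdivision W A).Adj (.inr (.inl e)) (.inr (.inl e')) := by
  simp [joinedSubdivision]

@[simp]
theorem joinedSubdivision_adj_edge_apex {e : W.edgeSet} {i : Unit} :
    (joinedSubdivision W A).Adj (.inr (.inl e)) (.inr (.inr i)) := by
  simp [joinedSubdivision]

@[simp]
theorem joinedSubdivision_adj_apex_edge {e : W.edgeSet} {i : Unit} :
    (joinedSubdivision W A).Adj (.inr (.inr i)) (.inr (.inl e)) := by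
  simp [joinedSubdivision]

@[simp]
theorem joinedSubdivision_adj_inl_apex {v : V} {i : Unit} :
    ¬(joinedSubdivision W A).Adj (.inl v) (.inr (.inr i)) := by
  simp [joinedSubdivision]

@[simp]
theorem joinedSubdivision_adj_apex_inl {v : V} {i : Unit} :
    ¬(joinedSubdivision W A).Adj (.inr (.inr i)) (.inl v) := by
  simp [joinedSubdivision]

/-- Each part (a value of `p`) of the vertex set of `W` that spans an edge of `W` cut by `S`
contributes an edge to an induced matching between `S` and its complement. -/
theorem HasFewNeighbourhoods.card_le_of_cut_edges {k : ℕ} {S : Set (V ⊕ (W.edgeSet ⊕ Unit))}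
    (h : HasFewNeighbourhoods (joinedSubdivision W A) k S) {ι : Type} (p : V → ι) (I : Finset ι)
    (hI : ∀ i ∈ I, ∃ u v, W.Adj u v ∧ p u = i ∧ p v = i ∧ Sum.inl u ∈ S ∧ Sum.inl v ∉ S) :
    I.card ≤ 2 * k := by
  obtain ⟨f, hf⟩ := h
  have key : ∀ i : I, ∃ (w : V) (e : W.edgeSet), w ∈ (e : Sym2 V) ∧ (∀ z ∈ (e : Sym2 V), p z = i) ∧
      ((Sum.inl w ∈ S ∧ Sum.inr (Sum.inl e) ∉ S) ∨ (Sum.inl w ∉ S ∧ Sum.inr (Sum.inl e) ∈ S)) := by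
    rintro ⟨i, hi⟩
    obtain ⟨u, v, huv, hu, hv, huS, hvS⟩ := hI i hi
    -- Whichever side the subdivision vertex is on, one half of the cut edge is cut.
    by_cases he : (Sum.inr (Sum.inl ⟨s(u, v), huv⟩) : V ⊕ (W.edgeSet ⊕ Unit)) ∈ S
    · exact ⟨v, ⟨s(u, v), huv⟩, by simp, by simp [hu, hv], .inr ⟨hvS, he⟩⟩
    · exact ⟨u, ⟨s(u, v), huv⟩, by simp, by simp [hu, hv], .inl ⟨huS, he⟩⟩
  choose w e hwe hpe hS using key
  classical
  -- The two kinds of end in `S` are kept apart, whence the factor 2: edges between `A` and `Aᶜ`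
  -- could spoil a comparison of a wall vertex with a subdivision vertex.
  let g : I → Fin k ⊕ Fin k := fun i =>
    if Sum.inl (w i) ∈ S then .inl (f (.inl (w i))) else .inr (f (.inr (.inl (e i))))
  have hg : Function.Injective g := by
    intro i j hij
    have hsep : w i ∈ (e j : Sym2 V) → i = j := fun h =>
      Subtype.ext ((hpe i _ (hwe i)).symm.trans (hpe j _ h))
    apply hsep
    rcases hS i with ⟨hi1, hi2⟩ | ⟨hi1, hi2⟩ <;> rcases hS j with ⟨hj1, hj2⟩ | ⟨hj1, hj2⟩ <;>
      simp only [g, hi1, hj1, if_true, if_false, reduceCtorEq, Sum.inl.injEq, Sum.inr.injEq] at hij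
    · simpa [hwe j] using hf _ hi1 _ hj1 hij _ hj2
    · simpa [hwe i] using hf _ hi2 _ hj2 hij _ hi1
  have := Fintype.card_le_of_injective g hg
  simp at this
  omega

end JoinedSubdivision

/-- If few rows and few columns of a square are bichromatic, one colour is rare. -/
theorem ncard_le_of_few_mixed {N m : ℕ} (hm : m < N) (P : Fin N × Fin N → Prop)
    (R C : Finset (Fin N)) (hR : R.card ≤ m) (hC : C.card ≤ m)
    (hrow : ∀ i ∉ R, ∀ j j', P (i, j) → P (i, j')) (hcol : ∀ j ∉ C, ∀ i i', P (i, j) → P (i', j)) :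
    {q | P q}.ncard ≤ m * m ∨ {q | ¬ P q}.ncard ≤ m * m := by
  have hRC : ((R ×ˢ C : Finset _) : Set (Fin N × Fin N)).ncard ≤ m * m := by
    rw [Set.ncard_coe_finset, Finset.card_product]
    exact Nat.mul_le_mul hR hC
  -- A pure row and a pure column exist as `m < N`. The colour at their crossing spreads to every
  -- pure row and column, so the other colour is confined to `R ×ˢ C`.
  obtain ⟨i0, hi0⟩ : ∃ i, i ∉ R := by
    by_contra! h
    have := Finset.card_le_card (fun i _ => h i : Finset.univ ⊆ R)
    simp at this; omega
  obtain ⟨j0, hj0⟩ : ∃ i, i ∉ C := by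
    by_contra! h
    have := Finset.card_le_card (fun i _ => h i : Finset.univ ⊆ C)
    simp at this; omega
  by_cases h0 : P (i0, j0)
  · right
    refine (Set.ncard_le_ncard ?_ (Finset.finite_toSet _)).trans hRC
    rintro ⟨i, j⟩ hq
    simp only [Finset.coe_product, Set.mem_prod, Finset.mem_coe]
    by_contra hcon
    rw [not_and_or] at hcon
    apply hq
    rcases hcon with h | h
    · exact hrow i h _ _ (hcol j0 hj0 _ _ h0)
    · exact hcol j h _ _ (hrow i0 hi0 _ _ h0)
  · left
    refine (Set.ncard_le_ncard ?_ (Finset.finite_toSet _)).trans hRC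
    rintro ⟨i, j⟩ hq
    simp only [Finset.coe_product, Set.mem_prod, Finset.mem_coe]
    by_contra hcon
    rw [not_and_or] at hcon
    apply h0
    rcases hcon with h | h
    · exact hcol j0 hj0 _ _ (hrow i h _ _ hq)
    · exact hrow i0 hi0 _ _ (hcol j h _ _ hq)

/-! ### Grids in walls and unbounded clique-width -/

section Wall

instance (n : ℕ) : Finite (WallVertex n) := by
  unfold WallVertex; infer_instance

/-- The vertex in column `x` and row `y`, away from the outermost columns. -/
def wallPoint (n x y : ℕ) (hx : 1 ≤ x ∧ x ≤ 2 * n) (hy : y ≤ n) : WallVertex n :=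
  ⟨(⟨x, by omega⟩, ⟨y, by omega⟩), by simp; omega, by simp; split_ifs <;> omega⟩

theorem wall_adj_horizontal {n x y : ℕ} (hx : 1 ≤ x ∧ x + 1 ≤ 2 * n) (hy : y ≤ n) :
    (wall n).Adj (wallPoint n x y (by omega) hy) (wallPoint n (x + 1) y (by omega) hy) := by
  refine (SimpleGraph.fromRel_adj _ _ _).2 ⟨fun h => ?_, .inl (.inl ⟨rfl, rfl⟩)⟩
  have : x = x + 1 := congrArg (fun u : WallVertex n => u.1.1.val) h
  omega

theorem wall_adj_vertical {n x y : ℕ} (hx : 1 ≤ x ∧ x ≤ 2 * n) (hy : y + 1 ≤ n)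
    (h : Odd (x + y)) :
    (wall n).Adj (wallPoint n x y hx (by omega)) (wallPoint n x (y + 1) hx hy) := by
  refine (SimpleGraph.fromRel_adj _ _ _).2 ⟨fun h => ?_, .inl (.inr ⟨rfl, rfl, h⟩)⟩
  have : y = y + 1 := congrArg (fun u : WallVertex n => u.1.2.val) h
  omega

/-- A property preserved along the edges inside row `y` is constant on that row. -/
theorem wall_row_monochromatic {n y : ℕ} (hy : y ≤ n) (P : WallVertex n → Prop)
    (hP : ∀ u v, (wall n).Adj u v → u.1.2.val = y → v.1.2.val = y → P u → P v)
    {x x' : ℕ} (hx : 1 ≤ x ∧ x ≤ 2 * n) (hx' : 1 ≤ x' ∧ x' ≤ 2 * n)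
    (h : P (wallPoint n x y hx hy)) : P (wallPoint n x' y hx' hy) := by
  have step (x : ℕ) (hx : 1 ≤ x ∧ x + 1 ≤ 2 * n) :
      P (wallPoint n x y (by omega) hy) ↔ P (wallPoint n (x + 1) y (by omega) hy) :=
    ⟨hP _ _ (wall_adj_horizontal hx hy) rfl rfl, hP _ _ (wall_adj_horizontal hx hy).symm rfl rfl⟩
  have base (d : ℕ) (hd : 1 ≤ d + 1 ∧ d + 1 ≤ 2 * n) :
      P (wallPoint n 1 y (by omega) hy) ↔ P (wallPoint n (d + 1) y hd hy) := by
    induction d with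
    | zero => rfl
    | succ d ih => exact (ih (by omega)).trans (step _ (by omega))
  obtain ⟨d, rfl⟩ : ∃ d, x = d + 1 := ⟨x - 1, by omega⟩
  obtain ⟨d', rfl⟩ : ∃ d, x' = d + 1 := ⟨x' - 1, by omega⟩
  exact (base d' hx').1 ((base d hx).2 h)

/-- A property preserved along the edges inside the pair of columns `2 * j`, `2 * j + 1` is constant
on column `2 * j`. -/
theorem wall_column_monochromatic {n j : ℕ} (hj : 1 ≤ j ∧ j + 1 ≤ n) (P : WallVertex n → Prop)
    (hP : ∀ u v, (wall n).Adj u v → u.1.1.val / 2 = j → v.1.1.val / 2 = j → P u → P v)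
    {y y' : ℕ} (hy : y ≤ n) (hy' : y' ≤ n)
    (h : P (wallPoint n (2 * j) y (by omega) hy)) : P (wallPoint n (2 * j) y' (by omega) hy') := by
  have hh (y : ℕ) (hy : y ≤ n) : P (wallPoint n (2 * j) y (by omega) hy) ↔
      P (wallPoint n (2 * j + 1) y (by omega) hy) := by
    have e1 : (2 * j + 1) / 2 = j := by omega
    have e2 : (2 * j) / 2 = j := by omega
    exact ⟨hP _ _ (wall_adj_horizontal (by omega) hy) e2 e1,
      hP _ _ (wall_adj_horizontal (by omega) hy).symm e1 e2⟩
  have step (y : ℕ) (hy : y + 1 ≤ n) : P (wallPoint n (2 * j) y (by omega) (by omega)) ↔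
      P (wallPoint n (2 * j) (y + 1) (by omega) hy) := by
    have e1 : (2 * j + 1) / 2 = j := by omega
    have e2 : (2 * j) / 2 = j := by omega
    -- The edge from row `y` to row `y + 1` lies in column `2 * j + 1` for even `y` and in column `2
    -- * j` for odd `y`.
    rcases Nat.even_or_odd y with h | h
    · have := wall_adj_vertical (n := n) (x := 2 * j + 1) (by omega) hy (by grind)
      rw [hh, hh]
      exact ⟨hP _ _ this e1 e1, hP _ _ this.symm e1 e1⟩
    · have := wall_adj_vertical (n := n) (x := 2 * j) (by omega) hy (by grind)
      exact ⟨hP _ _ this e2 e2, hP _ _ this.symm e2 e2⟩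
  have base (d : ℕ) (hd : d ≤ n) : P (wallPoint n (2 * j) 0 (by omega) (by omega)) ↔
      P (wallPoint n (2 * j) d (by omega) hd) := by
    induction d with
    | zero => rfl
    | succ d ih => exact (ih (by omega)).trans (step _ (by omega))
  exact (base y' hy').1 ((base y hy).2 h)

/-- In a large wall, a balanced vertex set of the witness graph has many neighbourhoods. -/
theorem exists_set_without_balanced_few (c : ℕ) : ∃ n t : ℕ, 2 ≤ n ∧ 1 ≤ t ∧
    ∃ D : Set (WallVertex n ⊕ ((wall n).edgeSet ⊕ Unit)), t < D.ncard ∧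
      ∀ S, t < (D ∩ S).ncard → (D ∩ S).ncard ≤ 2 * t →
        ¬ HasFewNeighbourhoods (witness n) c S := by
  set N := 4 * c + 4 with hN
  let g : Fin N × Fin N → WallVertex (N + 1) ⊕ ((wall (N + 1)).edgeSet ⊕ Unit) := fun q =>
    .inl (wallPoint (N + 1) (2 * (q.2.val + 1)) q.1.val (by omega) (by omega))
  have hg : Function.Injective g := by
    rintro ⟨⟨a, _⟩, ⟨b, _⟩⟩ ⟨⟨a', _⟩, ⟨b', _⟩⟩ h
    have h1 : 2 * (b + 1) = 2 * (b' + 1) :=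
      congrArg (fun u : WallVertex (N + 1) => u.1.1.val) (Sum.inl_injective h)
    have h2 : a = a' := congrArg (fun u : WallVertex (N + 1) => u.1.2.val) (Sum.inl_injective h)
    simp only [Prod.mk.injEq, Fin.mk.injEq]
    omega
  have hcard : (Set.range g).ncard = N * N := by
    rw [← Set.image_univ, Set.ncard_image_of_injective _ hg, Set.ncard_univ]
    simp
  -- A rare colour has at most `(2 * c) ^ 2 < t` points, while `S` takes more than `t` and misses at
  -- least `N * N - 2 * t`, which also exceeds that bound.
  refine ⟨N + 1, 4 * c * c + 1, by omega, by omega, Set.range g, ?_, ?_⟩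
  · rw [hcard]; nlinarith
  intro S h1 h2 hS
  have hpre : (Set.range g ∩ S).ncard = {q | g q ∈ S}.ncard := by
    rw [← Set.ncard_image_of_injective _ hg]
    exact congrArg Set.ncard (Set.image_preimage_eq_range_inter (f := g) (t := S)).symm
  rw [hpre] at h1 h2
  have hcompl : {q | g q ∈ S}.ncard + {q | ¬ g q ∈ S}.ncard = N * N := by
    have := Set.ncard_add_ncard_compl {q | g q ∈ S}
    simpa [Set.compl_ofPred] using this
  classical
  let R : Finset (Fin N) := {i | ∃ u v, (wall (N + 1)).Adj u v ∧ u.1.2.val = i.val ∧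
    v.1.2.val = i.val ∧ Sum.inl u ∈ S ∧ Sum.inl v ∉ S}
  let C : Finset (Fin N) := {j | ∃ u v, (wall (N + 1)).Adj u v ∧ u.1.1.val / 2 = j.val + 1 ∧
    v.1.1.val / 2 = j.val + 1 ∧ Sum.inl u ∈ S ∧ Sum.inl v ∉ S}
  have hR : R.card ≤ 2 * c := by
    rw [← Finset.card_map Fin.valEmbedding]
    refine hS.card_le_of_cut_edges (fun u => u.1.2.val) _ fun i hi => ?_
    obtain ⟨i, hi', rfl⟩ := Finset.mem_map.1 hi
    exact (Finset.mem_filter_univ i).1 hi'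
  have hC : C.card ≤ 2 * c := by
    rw [← Finset.card_map (Fin.valEmbedding.trans (addRightEmbedding 1))]
    refine hS.card_le_of_cut_edges (fun u => u.1.1.val / 2) _ fun i hi => ?_
    obtain ⟨i, hi', rfl⟩ := Finset.mem_map.1 hi
    exact (Finset.mem_filter_univ i).1 hi'
  have := ncard_le_of_few_mixed (by omega) (fun q => g q ∈ S) R C hR hC ?_ ?_
  · have : 2 * c * (2 * c) = 4 * c * c := by ring
    rcases ‹_ ∨ _› with h | h
    · omega
    · have : N * N = 16 * c * c + 32 * c + 16 := by rw [hN]; ring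
      have : 16 * c * c = 4 * (4 * c * c) := by ring
      omega
  · intro i hi j j' h
    refine wall_row_monochromatic _ (fun u => Sum.inl u ∈ S) (fun u v huv hu hv huS => ?_) _ _ h
    by_contra hvS
    exact hi (by simpa [R] using ⟨u, v, huv, hu, hv, huS, hvS⟩)
  · intro j hj i i' h
    refine wall_column_monochromatic (by omega) (fun u => Sum.inl u ∈ S)
      (fun u v huv hu hv huS => ?_) _ _ h
    by_contra hvS
    exact hj (by simpa [C] using ⟨u, v, huv, hu, hv, huS, hvS⟩)

theorem exists_cliqueWidth_witness_gt (c : ℕ) :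
    ∃ n, 2 ≤ n ∧ ¬ cliqueWidth (witness n) ≤ c ∧ ¬ cliqueWidth (witness n)ᶜ ≤ c := by
  obtain ⟨n, t, hn, ht, D, hD, h⟩ := exists_set_without_balanced_few c
  refine ⟨n, hn, fun hc => ?_, fun hc => ?_⟩
  · obtain ⟨S, h1, h2, h3⟩ := exists_balanced_of_cliqueWidth_le hc ht D hD
    exact h S h1 h2 h3
  · obtain ⟨S, h1, h2, h3⟩ := exists_balanced_of_cliqueWidth_le hc ht D hD
    exact h S h1 h2 h3.of_compl

end Wall

/-! ### Forbidden induced subgraphs -/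

section Layered

/-- The vertex set of `G` is covered by independent sets `A`, `C`, `B` and a vertex `x` such that
`A` is complete to `C`, `x` is adjacent to exactly the vertices of `B`, and a vertex of `B` has at
most one neighbour in each of `A` and `C` and is determined by these two neighbours. -/
structure IsLayered {X : Type} (G : SimpleGraph X) (A C B : X → Prop) (x : X) : Prop where
  cover : ∀ v, A v ∨ C v ∨ B v ∨ v = x
  not_A_A : ∀ u v, A u → A v → ¬ G.Adj u v
  not_C_C : ∀ u v, C u → C v → ¬ G.Adj u v
  not_B_B : ∀ u v, B u → B v → ¬ G.Adj u v
  A_C : ∀ u v, A u → C v → G.Adj u v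
  B_x : ∀ u, B u → G.Adj u x
  not_A_x : ∀ u, A u → ¬ G.Adj u x
  not_C_x : ∀ u, C u → ¬ G.Adj u x
  B_A : ∀ b u v, B b → A u → A v → G.Adj b u → G.Adj b v → u = v
  B_C : ∀ b u v, B b → C u → C v → G.Adj b u → G.Adj b v → u = v
  B_unique : ∀ a c b b', A a → C c → B b → B b' → G.Adj b a → G.Adj b c → G.Adj b' a →
    G.Adj b' c → b = b'

variable {X : Type} {G : SimpleGraph X} {A C B : X → Prop} {x : X}

/-- If `x` is on the `P₄`, the `P₂` avoids `B`, so it joins `A` to `C` and the `P₄` lies in the star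
on `B` and `x`. If `x` is on the `P₂`, the `P₄` lies in a complete bipartite graph. Otherwise the
`P₂` meets `A`, say, so the `P₄` lies in `A ∪ B` and an inner vertex from `B` has two neighbours in
`A`. -/
theorem IsLayered.isFreeOf_P2AddP4 (h : IsLayered G A C B x) : IsFreeOf P2AddP4 G := by
  rintro ⟨g⟩
  have k (p q) : G.Adj (g p) (g q) ↔ P2AddP4.Adj p q := g.map_rel_iff
  have n (p q) : g p = g q ↔ p = q := g.injective.eq_iff
  obtain ⟨a, ha⟩ : ∃ a, a = g (.inl 0) := ⟨_, rfl⟩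
  obtain ⟨b, hb⟩ : ∃ b, b = g (.inl 1) := ⟨_, rfl⟩
  obtain ⟨c, hc⟩ : ∃ c, c = g (.inr 0) := ⟨_, rfl⟩
  obtain ⟨d, hd⟩ : ∃ d, d = g (.inr 1) := ⟨_, rfl⟩
  obtain ⟨e, he⟩ : ∃ e, e = g (.inr 2) := ⟨_, rfl⟩
  obtain ⟨f, hf⟩ : ∃ f, f = g (.inr 3) := ⟨_, rfl⟩
  have hab : G.Adj a b := by simp [ha, hb, k, SimpleGraph.pathGraph_adj]
  have hcd : G.Adj c d := by simp [hc, hd, k, SimpleGraph.pathGraph_adj]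
  have hde : G.Adj d e := by simp [hd, he, k, SimpleGraph.pathGraph_adj]
  have hef : G.Adj e f := by simp [he, hf, k, SimpleGraph.pathGraph_adj]
  have hac : ¬ G.Adj a c := by simp [ha, hc, k]
  have had : ¬ G.Adj a d := by simp [ha, hd, k]
  have hae : ¬ G.Adj a e := by simp [ha, he, k]
  have haf : ¬ G.Adj a f := by simp [ha, hf, k]
  have hbc : ¬ G.Adj b c := by simp [hb, hc, k]
  have hbd : ¬ G.Adj b d := by simp [hb, hd, k]
  have hbe : ¬ G.Adj b e := by simp [hb, he, k]
  have hbf : ¬ G.Adj b f := by simp [hb, hf, k]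
  have hce : ¬ G.Adj c e := by simp [hc, he, k, SimpleGraph.pathGraph_adj]
  have hcf : ¬ G.Adj c f := by simp [hc, hf, k, SimpleGraph.pathGraph_adj]
  have hdf : ¬ G.Adj d f := by simp [hd, hf, k, SimpleGraph.pathGraph_adj]
  have nce : c ≠ e := by simp [hc, he, n]
  have ndf : d ≠ f := by simp [hd, hf, n]
  clear ha hb hc hd he hf k n
  have s (u v : X) := G.adj_comm u v
  have i := @G.irrefl
  obtain ⟨cover, AA, CC, BB, AC, Bx, Ax, Cx, BA, BC, -⟩ := h
  have ha := cover a
  have hb := cover b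
  have hc := cover c
  have hd := cover d
  have he := cover e
  have hf := cover f
  clear cover
  grind

/-- Consider the isolated vertex. If it is `x`, the path lies in a complete bipartite graph. If it
is in `A` (or `C`), the path alternates between `B` and `A ∪ {x}`; inner vertices from `B` force `x`
onto the path, where it has three neighbours. If it is in `B`, the path avoids `x` and meets both
`A` and `C`, since an inner vertex from `B` cannot have two neighbours in one of them. Its at least
three vertices in `A ∪ C` form a consecutive triple, and the other three are not independent. -/
theorem IsLayered.isFreeOf_P1AddP6 (h : IsLayered G A C B x) : IsFreeOf P1AddP6 G := by
  rintro ⟨g⟩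
  have k (p q) : G.Adj (g p) (g q) ↔ P1AddP6.Adj p q := g.map_rel_iff
  have n (p q) : g p = g q ↔ p = q := g.injective.eq_iff
  obtain ⟨v, hv⟩ : ∃ v, v = g (.inl 0) := ⟨_, rfl⟩
  obtain ⟨a, ha⟩ : ∃ a, a = g (.inr 0) := ⟨_, rfl⟩
  obtain ⟨b, hb⟩ : ∃ b, b = g (.inr 1) := ⟨_, rfl⟩
  obtain ⟨c, hc⟩ : ∃ c, c = g (.inr 2) := ⟨_, rfl⟩
  obtain ⟨d, hd⟩ : ∃ d, d = g (.inr 3) := ⟨_, rfl⟩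
  obtain ⟨e, he⟩ : ∃ e, e = g (.inr 4) := ⟨_, rfl⟩
  obtain ⟨f, hf⟩ : ∃ f, f = g (.inr 5) := ⟨_, rfl⟩
  have hab : G.Adj a b := by simp [ha, hb, k, SimpleGraph.pathGraph_adj]
  have hbc : G.Adj b c := by simp [hb, hc, k, SimpleGraph.pathGraph_adj]
  have hcd : G.Adj c d := by simp [hc, hd, k, SimpleGraph.pathGraph_adj]
  have hde : G.Adj d e := by simp [hd, he, k, SimpleGraph.pathGraph_adj]
  have hef : G.Adj e f := by simp [he, hf, k, SimpleGraph.pathGraph_adj]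
  have hva : ¬ G.Adj v a := by simp [hv, ha, k]
  have hvb : ¬ G.Adj v b := by simp [hv, hb, k]
  have hvc : ¬ G.Adj v c := by simp [hv, hc, k]
  have hvd : ¬ G.Adj v d := by simp [hv, hd, k]
  have hve : ¬ G.Adj v e := by simp [hv, he, k]
  have hvf : ¬ G.Adj v f := by simp [hv, hf, k]
  have hac : ¬ G.Adj a c := by simp [ha, hc, k, SimpleGraph.pathGraph_adj]
  have had : ¬ G.Adj a d := by simp [ha, hd, k, SimpleGraph.pathGraph_adj]
  have hae : ¬ G.Adj a e := by simp [ha, he, k, SimpleGraph.pathGraph_adj]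
  have haf : ¬ G.Adj a f := by simp [ha, hf, k, SimpleGraph.pathGraph_adj]
  have hbd : ¬ G.Adj b d := by simp [hb, hd, k, SimpleGraph.pathGraph_adj]
  have hbe : ¬ G.Adj b e := by simp [hb, he, k, SimpleGraph.pathGraph_adj]
  have hbf : ¬ G.Adj b f := by simp [hb, hf, k, SimpleGraph.pathGraph_adj]
  have hce : ¬ G.Adj c e := by simp [hc, he, k, SimpleGraph.pathGraph_adj]
  have hcf : ¬ G.Adj c f := by simp [hc, hf, k, SimpleGraph.pathGraph_adj]
  have hdf : ¬ G.Adj d f := by simp [hd, hf, k, SimpleGraph.pathGraph_adj]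
  have nac : a ≠ c := by simp [ha, hc, n]
  have nbd : b ≠ d := by simp [hb, hd, n]
  have nce : c ≠ e := by simp [hc, he, n]
  have ndf : d ≠ f := by simp [hd, hf, n]
  have nva : v ≠ a := by simp [hv, ha, n]
  have nvb : v ≠ b := by simp [hv, hb, n]
  have nvc : v ≠ c := by simp [hv, hc, n]
  have nvd : v ≠ d := by simp [hv, hd, n]
  have nve : v ≠ e := by simp [hv, he, n]
  have nvf : v ≠ f := by simp [hv, hf, n]
  clear hv ha hb hc hd he hf k n
  have s (u v : X) := G.adj_comm u v
  have i := @G.irrefl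
  obtain ⟨cover, AA, CC, BB, AC, Bx, Ax, Cx, BA, BC, -⟩ := h
  have hv := cover v
  have ha := cover a
  have hb := cover b
  have hc := cover c
  have hd := cover d
  have he := cover e
  have hf := cover f
  clear cover
  grind

/-- A triangle has one vertex in each of `A`, `C`, `B`. Two triangles sharing an edge thus have
their third vertices in the same class, against `B_A`, `B_C` or `B_unique`. -/
theorem IsLayered.isFreeOf_diamond (h : IsLayered G A C B x) : IsFreeOf twoP1AddP2ᶜ G := by
  rintro ⟨g⟩
  have k (p q) : G.Adj (g p) (g q) ↔ twoP1AddP2ᶜ.Adj p q := g.map_rel_iff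
  have n (p q) : g p = g q ↔ p = q := g.injective.eq_iff
  obtain ⟨a, ha⟩ : ∃ a, a = g (.inr 0) := ⟨_, rfl⟩
  obtain ⟨b, hb⟩ : ∃ b, b = g (.inr 1) := ⟨_, rfl⟩
  obtain ⟨c, hc⟩ : ∃ c, c = g (.inl (.inl 0)) := ⟨_, rfl⟩
  obtain ⟨d, hd⟩ : ∃ d, d = g (.inl (.inr 0)) := ⟨_, rfl⟩
  have hab : ¬ G.Adj a b := by simp [ha, hb, k, SimpleGraph.pathGraph_adj]
  have hac : G.Adj a c := by simp [ha, hc, k]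
  have had : G.Adj a d := by simp [ha, hd, k]
  have hbc : G.Adj b c := by simp [hb, hc, k]
  have hbd : G.Adj b d := by simp [hb, hd, k]
  have hcd : G.Adj c d := by simp [hc, hd, k]
  have nab : a ≠ b := by simp [ha, hb, n]
  clear ha hb hc hd k n
  have s (u v : X) := G.adj_comm u v
  have i := @G.irrefl
  obtain ⟨cover, AA, CC, BB, AC, Bx, Ax, Cx, BA, BC, BU⟩ := h
  have ha := cover a
  have hb := cover b
  have hc := cover c
  have hd := cover d
  clear cover
  grind

end Layered

theorem joinedSubdivision_isLayered {V : Type} {W : SimpleGraph V} {A : Set V}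
    (hW : W.IsBipartiteWith A Aᶜ) :
    IsLayered (joinedSubdivision W A) (fun v => ∃ u ∈ A, v = .inl u) (fun v => ∃ u ∉ A, v = .inl u)
      (fun v => ∃ e, v = .inr (.inl e)) (.inr (.inr ())) := by
  have hend (e : W.edgeSet) {u v : V} (hu : u ∈ (e : Sym2 V)) (hv : v ∈ (e : Sym2 V))
      (huv : u ∈ A ↔ v ∈ A) : u = v := by
    by_contra hne
    obtain ⟨e, he⟩ := e
    obtain rfl := (Sym2.mem_and_mem_iff hne).1 ⟨hu, hv⟩
    have := hW.mem_of_adj ((SimpleGraph.mem_edgeSet _).1 he)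
    simp only [Set.mem_compl_iff] at this
    tauto
  constructor
  · rintro (v | e | _)
    · by_cases hv : v ∈ A <;> simp [hv]
    · simp
    · simp
  · rintro _ _ ⟨u, hu, rfl⟩ ⟨v, hv, rfl⟩; simp [hu, hv]
  · rintro _ _ ⟨u, hu, rfl⟩ ⟨v, hv, rfl⟩; simp [hu, hv]
  · rintro _ _ ⟨u, rfl⟩ ⟨v, rfl⟩; simp
  · rintro _ _ ⟨u, hu, rfl⟩ ⟨v, hv, rfl⟩; simp [hu, hv]
  · rintro _ ⟨u, rfl⟩; simp
  · rintro _ ⟨u, hu, rfl⟩; simp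
  · rintro _ ⟨u, hu, rfl⟩; simp
  · rintro _ _ _ ⟨e, rfl⟩ ⟨u, hu, rfl⟩ ⟨v, hv, rfl⟩ h1 h2
    simp only [joinedSubdivision_adj_edge_inl] at h1 h2
    rw [hend e h1 h2 (by simp [hu, hv])]
  · rintro _ _ _ ⟨e, rfl⟩ ⟨u, hu, rfl⟩ ⟨v, hv, rfl⟩ h1 h2
    simp only [joinedSubdivision_adj_edge_inl] at h1 h2
    rw [hend e h1 h2 (by simp [hu, hv])]
  · rintro _ _ _ _ ⟨u, hu, rfl⟩ ⟨v, hv, rfl⟩ ⟨e, rfl⟩ ⟨e', rfl⟩ h1 h2 h3 h4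
    simp only [joinedSubdivision_adj_edge_inl] at h1 h2 h3 h4
    have hne : u ≠ v := fun h => hv (h ▸ hu)
    rw [Subtype.ext (((Sym2.mem_and_mem_iff hne).1 ⟨h1, h2⟩).trans
      ((Sym2.mem_and_mem_iff hne).1 ⟨h3, h4⟩).symm)]

theorem IsFreeOf.compl {V X : Type} {F : SimpleGraph V} {G : SimpleGraph X} (h : IsFreeOf F G) :
    IsFreeOf Fᶜ Gᶜ :=
  fun hF => h (SimpleGraph.compl_isIndContained_compl.1 hF)

/-! ### Absence of clique cut-sets -/

section Atom

variable {V : Type} {W : SimpleGraph V} {A : Set V}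

theorem SimpleGraph.induce_reachable_of_adj {X : Type} {G : SimpleGraph X} {s : Set X} {u v : X}
    (hu : u ∈ s) (hv : v ∈ s) (h : G.Adj u v) : (G.induce s).Reachable ⟨u, hu⟩ ⟨v, hv⟩ :=
  SimpleGraph.Adj.reachable (SimpleGraph.induce_adj.2 h)

theorem SimpleGraph.preconnected_of_reachable_root {X : Type} {G : SimpleGraph X} (r : X)
    (h : ∀ v, G.Reachable v r) : G.Preconnected :=
  fun u v => (h u).trans (h v).symm

-- A clique containing `x` misses `V`, which stays connected as a complete bipartite graph and
-- reaches every subdivision vertex. A clique avoiding `x` has at most one subdivision vertex, so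
-- each wall vertex keeps a path of length two to `x`.
open SimpleGraph in
theorem joinedSubdivision_isAtomGraph [Nonempty V] (hW : W.IsBipartiteWith A Aᶜ)
    (hdeg : ∀ v, ∃ e e' : W.edgeSet, e ≠ e' ∧ v ∈ (e : Sym2 V) ∧ v ∈ (e' : Sym2 V)) :
    IsAtomGraph (joinedSubdivision W A) := by
  rintro K ⟨hK, hcon⟩
  apply hcon
  by_cases hx : Sum.inr (Sum.inr ()) ∈ K
  · have hin (v : V) : Sum.inl v ∈ Kᶜ := fun hv => by
      simpa using hK hv hx (by simp)
    obtain ⟨u, v, hu, hv⟩ : ∃ u v, u ∈ A ∧ v ∉ A := by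
      obtain ⟨⟨e, he⟩, -⟩ := hdeg (Classical.arbitrary V)
      induction e with | _ u v =>
      have := hW.mem_of_adj ((SimpleGraph.mem_edgeSet _).1 he)
      simp only [Set.mem_compl_iff] at this
      rcases this with h | h
      · exact ⟨u, v, h.1, h.2⟩
      · exact ⟨v, u, h.2, h.1⟩
    have hinl (w : V) : ((joinedSubdivision W A).induce Kᶜ).Reachable ⟨.inl w, hin w⟩
        ⟨.inl u, hin u⟩ := by
      by_cases hw : w ∈ A
      · exact (induce_reachable_of_adj _ (hin v) (by simp [hw, hv])).trans
          (induce_reachable_of_adj _ _ (by simp [hu, hv]))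
      · exact induce_reachable_of_adj _ _ (by simp [hu, hw])
    refine preconnected_of_reachable_root ⟨.inl u, hin u⟩ ?_
    rintro ⟨w | e | _, hwK⟩
    · exact hinl w
    · obtain ⟨w, hw⟩ : ∃ w, w ∈ (e : Sym2 V) := ⟨_, Sym2.out_fst_mem _⟩
      exact (induce_reachable_of_adj _ (hin w) (by simpa using hw)).trans (hinl w)
    · exact absurd hx hwK
  · refine preconnected_of_reachable_root ⟨.inr (.inr ()), hx⟩ ?_
    rintro ⟨w | e | _, hwK⟩
    · obtain ⟨e, he, hwe⟩ : ∃ e : W.edgeSet, Sum.inr (Sum.inl e) ∈ Kᶜ ∧ w ∈ (e : Sym2 V) := by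
        obtain ⟨e, e', hne, he, he'⟩ := hdeg w
        by_cases heK : Sum.inr (Sum.inl e) ∈ K
        · refine ⟨e', fun heK' => ?_, he'⟩
          simpa using hK heK heK' (by simpa using hne)
        · exact ⟨e, heK, he⟩
      exact (induce_reachable_of_adj _ he (by simpa using hwe)).trans
        (induce_reachable_of_adj _ _ (by simp))
    · exact induce_reachable_of_adj _ _ (by simp)
    · rfl

-- In the complement, a clique containing `x` misses the subdivision vertices, which form a clique
-- reached from every vertex of `V`. A clique avoiding `x` cannot meet both `A` and its complement,
-- so each subdivision vertex keeps a neighbour in `V`, and all of `V` sees `x`.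
open SimpleGraph in
theorem joinedSubdivision_compl_isAtomGraph
    (hA : ∀ e : W.edgeSet, ∃ a ∈ A, a ∉ (e : Sym2 V))
    (hC : ∀ e : W.edgeSet, ∃ c ∉ A, c ∉ (e : Sym2 V))
    (hE : ∀ v, ∃ e : W.edgeSet, v ∉ (e : Sym2 V)) :
    IsAtomGraph (joinedSubdivision W A)ᶜ := by
  rintro K ⟨hK, hcon⟩
  apply hcon
  by_cases hx : Sum.inr (Sum.inr ()) ∈ K
  · have hin (e : W.edgeSet) : Sum.inr (Sum.inl e) ∈ Kᶜ := fun he => by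
      simpa [compl_adj] using hK he hx (by simp)
    have hedge (e e' : W.edgeSet) : ((joinedSubdivision W A)ᶜ.induce Kᶜ).Reachable
        ⟨.inr (.inl e), hin e⟩ ⟨.inr (.inl e'), hin e'⟩ := by
      by_cases hee : e = e'
      · subst hee; rfl
      · exact induce_reachable_of_adj _ _ (by simp [compl_adj, hee])
    have hto (p : (Kᶜ : Set _)) : ∃ e, ((joinedSubdivision W A)ᶜ.induce Kᶜ).Reachable p
        ⟨.inr (.inl e), hin e⟩ := by
      rcases p with ⟨w | e | _, hwK⟩
      · obtain ⟨e, he⟩ := hE w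
        exact ⟨e, induce_reachable_of_adj _ _ (by simp [compl_adj, he])⟩
      · exact ⟨e, by rfl⟩
      · exact absurd hx hwK
    intro p q
    obtain ⟨e, he⟩ := hto p
    obtain ⟨e', he'⟩ := hto q
    exact (he.trans (hedge e e')).trans he'.symm
  · have hinl (w : V) (hw : Sum.inl w ∈ Kᶜ) : ((joinedSubdivision W A)ᶜ.induce Kᶜ).Reachable
        ⟨.inl w, hw⟩ ⟨.inr (.inr ()), hx⟩ :=
      induce_reachable_of_adj _ _ (by simp [compl_adj])
    refine preconnected_of_reachable_root ⟨.inr (.inr ()), hx⟩ ?_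
    rintro ⟨w | e | _, hwK⟩
    · exact hinl w hwK
    · obtain ⟨w, hw, hwe⟩ : ∃ w, Sum.inl w ∈ Kᶜ ∧ w ∉ (e : Sym2 V) := by
        obtain ⟨a, ha, hae⟩ := hA e
        obtain ⟨c, hc, hce⟩ := hC e
        by_cases haK : Sum.inl a ∈ K
        · refine ⟨c, fun hcK => ?_, hce⟩
          simpa [compl_adj, ha, hc] using hK haK hcK (by simp; rintro rfl; exact hc ha)
        · exact ⟨a, haK, hae⟩
      exact (induce_reachable_of_adj _ hw (by simp [compl_adj, hwe])).trans (hinl w hw)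
    · rfl

end Atom

/-! ### Degrees and edges of the wall -/

section WallDegree

/-- The pairs `(x, y)` that are vertices of the wall of height `n`. -/
def IsWallCoord (n x y : ℕ) : Prop :=
  x ≤ 2 * n + 1 ∧ y ≤ n ∧ ¬ (x = 0 ∧ y = 0) ∧ (n % 2 = 0 → ¬ (x = 2 * n + 1 ∧ y = n)) ∧
    (n % 2 = 1 → ¬ (x = 0 ∧ y = n))

theorem isWallCoord_of_wallVertex {n : ℕ} (p : WallVertex n) :
    IsWallCoord n p.1.1.val p.1.2.val := by
  obtain ⟨⟨⟨x, hx⟩, ⟨y, hy⟩⟩, h1, h2⟩ := p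
  dsimp only at h1 h2
  unfold IsWallCoord
  by_cases hn : Even n
  · rw [if_pos hn] at h2
    rw [Nat.even_iff] at hn
    dsimp only
    omega
  · rw [if_neg hn] at h2
    rw [Nat.even_iff] at hn
    dsimp only
    omega

theorem IsWallCoord.exists_wallVertex {n x y : ℕ} (h : IsWallCoord n x y) :
    ∃ q : WallVertex n, q.1.1.val = x ∧ q.1.2.val = y := by
  obtain ⟨hx, hy, h1, h2, h3⟩ := h
  refine ⟨⟨(⟨x, by omega⟩, ⟨y, by omega⟩), h1, ?_⟩, rfl, rfl⟩
  simp only [Nat.even_iff]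
  split_ifs <;> omega

/-- Adjacency in the wall in terms of coordinates. -/
def WallCoordAdj (x y x' y' : ℕ) : Prop :=
  (y = y' ∧ (x + 1 = x' ∨ x' + 1 = x)) ∨
    (x = x' ∧ (y + 1 = y' ∧ (x + y) % 2 = 1 ∨ y' + 1 = y ∧ (x + y) % 2 = 0))

theorem wall_adj_of_coord {n : ℕ} {p q : WallVertex n}
    (h : WallCoordAdj p.1.1.val p.1.2.val q.1.1.val q.1.2.val) : (wall n).Adj p q := by
  refine (SimpleGraph.fromRel_adj _ _ _).2 ⟨?_, ?_⟩
  · rintro rfl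
    unfold WallCoordAdj at h
    omega
  · simp only [Nat.odd_iff]
    unfold WallCoordAdj at h
    omega

theorem IsWallCoord.exists_two_neighbours {n x y : ℕ} (hn : 1 ≤ n) (h : IsWallCoord n x y) :
    ∃ x₁ y₁ x₂ y₂, IsWallCoord n x₁ y₁ ∧ IsWallCoord n x₂ y₂ ∧ ¬ (x₁ = x₂ ∧ y₁ = y₂) ∧
      WallCoordAdj x y x₁ y₁ ∧ WallCoordAdj x y x₂ y₂ := by
  unfold IsWallCoord at *
  unfold WallCoordAdj
  -- `y'` is the row of the vertical neighbour. It replaces a horizontal neighbour missing at the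
  -- boundary or at a deleted corner; in those cases `y - 1` is never truncated.
  obtain ⟨y', hy'⟩ : ∃ y', (x + y) % 2 = 1 ∧ y' = y + 1 ∨ (x + y) % 2 = 0 ∧ y' = y - 1 := by
    rcases Nat.mod_two_eq_zero_or_one (x + y) with h | h
    · exact ⟨_, .inr ⟨h, rfl⟩⟩
    · exact ⟨_, .inl ⟨h, rfl⟩⟩
  by_cases hl : x = 0 ∨ x = 1 ∧ (y = 0 ∨ n % 2 = 1 ∧ y = n)
  · exact ⟨x + 1, y, x, y', by omega⟩
  by_cases hr : x = 2 * n + 1 ∨ x = 2 * n ∧ n % 2 = 0 ∧ y = n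
  · exact ⟨x - 1, y, x, y', by omega⟩
  exact ⟨x - 1, y, x + 1, y, by omega⟩

theorem wall_exists_two_neighbours {n : ℕ} (hn : 1 ≤ n) (p : WallVertex n) :
    ∃ q q', q ≠ q' ∧ (wall n).Adj p q ∧ (wall n).Adj p q' := by
  obtain ⟨x₁, y₁, x₂, y₂, h₁, h₂, hne, ha₁, ha₂⟩ :=
    (isWallCoord_of_wallVertex p).exists_two_neighbours hn
  obtain ⟨q, rfl, rfl⟩ := h₁.exists_wallVertex
  obtain ⟨q', rfl, rfl⟩ := h₂.exists_wallVertex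
  refine ⟨q, q', ?_, wall_adj_of_coord ha₁, wall_adj_of_coord ha₂⟩
  rintro rfl
  exact hne ⟨rfl, rfl⟩

theorem wall_edge_avoids {n : ℕ} (e : (wall n).edgeSet) {u v : WallVertex n} (hne : u ≠ v)
    (h : u ∈ wallSide n ↔ v ∈ wallSide n) : u ∉ (e : Sym2 (WallVertex n)) ∨ v ∉ (e : Sym2 _) := by
  by_contra! hcon
  obtain ⟨e, he⟩ := e
  obtain rfl := (Sym2.mem_and_mem_iff hne).1 hcon
  have := (wall_isBipartiteWith n).mem_of_adj ((SimpleGraph.mem_edgeSet _).1 he)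
  simp only [Set.mem_compl_iff] at this
  tauto

theorem witness_isAtomGraph {n : ℕ} (hn : 2 ≤ n) : IsAtomGraph (witness n) := by
  have : Nonempty (WallVertex n) := ⟨wallPoint n 1 0 (by omega) (by omega)⟩
  refine joinedSubdivision_isAtomGraph (wall_isBipartiteWith n) fun v => ?_
  obtain ⟨q, q', hne, h, h'⟩ := wall_exists_two_neighbours (by omega) v
  exact ⟨⟨s(v, q), h⟩, ⟨s(v, q'), h'⟩,
    fun h => hne (Sym2.congr_right.1 (congrArg Subtype.val h)), by simp, by simp⟩

theorem witness_compl_isAtomGraph {n : ℕ} (hn : 2 ≤ n) : IsAtomGraph (witness n)ᶜ := by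
  have hne {x x' : ℕ} (hx : 1 ≤ x ∧ x ≤ 2 * n) (hx' : 1 ≤ x' ∧ x' ≤ 2 * n) (h : x ≠ x') :
      wallPoint n x 0 hx (by omega) ≠ wallPoint n x' 0 hx' (by omega) := fun he =>
    h (congrArg (fun u : WallVertex n => u.1.1.val) he)
  have hside {x : ℕ} (hx : 1 ≤ x ∧ x ≤ 2 * n) :
      wallPoint n x 0 hx (by omega) ∈ wallSide n ↔ Even x := Iff.rfl
  refine joinedSubdivision_compl_isAtomGraph (fun e => ?_) (fun e => ?_) fun v => ?_
  · have h2 : Even 2 := by decide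
    have h4 : Even 4 := by decide
    rcases wall_edge_avoids e (hne (x := 2) (x' := 4) (by omega) (by omega) (by omega))
      (by simp [hside, h2, h4]) with h | h
    · exact ⟨_, (hside _).2 h2, h⟩
    · exact ⟨_, (hside _).2 h4, h⟩
  · have h1 : ¬ Even 1 := by decide
    have h3 : ¬ Even 3 := by decide
    rcases wall_edge_avoids e (hne (x := 1) (x' := 3) (by omega) (by omega) (by omega))
      (by simp [hside, h1, h3]) with h | h
    · exact ⟨_, mt (hside _).1 h1, h⟩
    · exact ⟨_, mt (hside _).1 h3, h⟩
  -- The edges on columns 1, 2 and 3, 4 of row 0 are disjoint, so no vertex lies on both.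
  · by_contra! hcon
    have h1 := Sym2.mem_iff.1 (hcon
      ⟨s(_, _), wall_adj_horizontal (x := 1) (y := 0) (by omega) (by omega)⟩)
    have h2 := Sym2.mem_iff.1 (hcon
      ⟨s(_, _), wall_adj_horizontal (x := 3) (y := 0) (by omega) (by omega)⟩)
    rcases h1 with h1 | h1 <;> rcases h2 with h2 | h2
    · exact hne (x := 1) (x' := 3) (by omega) (by omega) (by omega) (h1.symm.trans h2)
    · exact hne (x := 1) (x' := 4) (by omega) (by omega) (by omega) (h1.symm.trans h2)
    · exact hne (x := 2) (x' := 3) (by omega) (by omega) (by omega) (h1.symm.trans h2)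
    · exact hne (x := 2) (x' := 4) (by omega) (by omega) (by omega) (h1.symm.trans h2)

end WallDegree

theorem witness_mem_diamondFreeAtoms {n : ℕ} (hn : 2 ≤ n) : diamondFreeAtoms _ (witness n) := by
  have h : IsLayered (witness n) _ _ _ _ := joinedSubdivision_isLayered (wall_isBipartiteWith n)
  exact ⟨witness_isAtomGraph hn, h.isFreeOf_diamond, h.isFreeOf_P2AddP4, h.isFreeOf_P1AddP6⟩

theorem witness_compl_mem_coDiamondFreeAtoms {n : ℕ} (hn : 2 ≤ n) :
    coDiamondFreeAtoms _ (witness n)ᶜ := by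
  have h : IsLayered (witness n) _ _ _ _ := joinedSubdivision_isLayered (wall_isBipartiteWith n)
  exact ⟨witness_compl_isAtomGraph hn, compl_compl twoP1AddP2 ▸ h.isFreeOf_diamond.compl,
    h.isFreeOf_P2AddP4.compl, h.isFreeOf_P1AddP6.compl⟩

theorem mainTheorem10 :
    (¬ BoundedCliqueWidth diamondFreeAtoms ∧ ¬ BoundedCliqueWidth coDiamondFreeAtoms) ∧
    (∀ n : ℕ, 2 ≤ n → diamondFreeAtoms _ (witness n) ∧ coDiamondFreeAtoms _ (witness n)ᶜ) ∧
    (¬ BoundedCliqueWidth witnessClass ∧ ¬ BoundedCliqueWidth coWitnessClass) := by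
  refine ⟨⟨?_, ?_⟩, fun n hn =>
    ⟨witness_mem_diamondFreeAtoms hn, witness_compl_mem_coDiamondFreeAtoms hn⟩, ?_, ?_⟩ <;>
  rintro ⟨c, hc⟩ <;> obtain ⟨n, hn, h, h'⟩ := exists_cliqueWidth_witness_gt c
  · exact h (hc _ _ (witness_mem_diamondFreeAtoms hn))
  · exact h' (hc _ _ (witness_compl_mem_coDiamondFreeAtoms hn))
  · exact h (hc _ _ ⟨n, hn, ⟨SimpleGraph.Iso.refl⟩⟩)
  · exact h' (hc _ _ ⟨n, hn, ⟨SimpleGraph.Iso.refl⟩⟩)
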